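/- **Setting.** An auction consists of a finite set $\mathcal U$ of $n$ users, a non-negative monotone submodular value function $V:2^{\mathcal U}\to\mathbb R$, costs $b_i>0$ (equal to the bids), a budget $B>0$, a deadline $T\in\mathbb N$, and time steps $1\le s_1<\dots<s_n\le T$ at which the users arrive one at a time, such that $\lfloor n/2\rfloor$ or $\lceil n/2\rceil$ of them are at most $\lfloor T/2\rfloor$. In the secretary model all of this is chosen by an adversary, while the order in which the users arrive is uniformly random among the $n!$ orders; all probabilities are over this order. Write $V_i(X)=V(X\cup\{i\})-V(X)$. **Proportional share rule.** For $X\subseteq\mathcal U$ and a budget $b>0$: start with $J=\emptyset$; let $i$ maximize $V_i(J)/b_i$ over $X\setminus J$ (ties broken arbitrarily); while $b_i\le V_i(J)\,b/V(J\cup\{i\})$, add $i$ to $J$ and repeat. Stop when the test fails (a quotient $0/0$ counting as $0$) or $X\setminus J$ is empty. The output is $J$. Let $Z$ be the output for $X=\mathcal U$, $b=B$ (the offline proportional-share solution). **OMZ** with parameters $\varepsilon>0$ and $\delta>1$. Let $L=\lfloor\log_2T\rfloor$. Stage $k\in\{1,\dots,L+1\}$ ends at time $\lfloor 2^{k-1}T/2^{L}\rfloor$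 and has budget $B'=2^{k-1}B/2^{L}$. The threshold $\rho^*$ is $\varepsilon$ in the first stage. Whenever a stage with budget $B'$ ends, $\rho^*$ is reset to $V(J)/(\delta B')$, where $J$ is the output of the proportional share rule on all users that have arrived, with budget $B'$. The set $S$ of selected users is initially empty. An arriving user $i$ is added to $S$, with payment $p_i=V_i(S)/\rho^*$, if $b_i\le V_i(S)/\rho^*\le B'-\sum_{j\in S}p_j$, where $B'$ is the budget of the current stage (no user is added while $\rho^*=0$). Let $Z_1'$ be the output of the proportional share rule with budget $B/2$ on the users that arrive by time $\lfloor T/2\rfloor$, and let $Z_2'$ be the set $S$ of users selected by OMZ when its last stage is over. **Lemma.** There are a constant probability $p>0$, a number $\omega_0$ and a function $r(\omega,\delta)$, none of them depending on the auction, on $\varepsilon$ or on the breaking of ties, such that the following hold. 1. For every $\delta>8$ there is a constant $\kappa>0$ such that $r(\omega,\delta)\ge\kappa$ for all sufficiently large $\omega$; moreover $r(\omega,\delta)\to\frac1{12}$ as $\omega\to\infty$ and $\delta\to12$. 2. Let $\omega\ge\omega_0$ and $\delta>1$. In every auction in which every user has value $V(\{i\})\le V(Z)/\omega$, with probability at least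 $p$ one has both $V(Z_1')\ge V(Z)/8$ and $V(Z_2')\ge r(\omega,\delta)\,V(Z_1')$. 3. For all sufficiently large $\omega$ and all $\delta$ sufficiently close to $12$, in every auction in which every user has value $V(\{i\})\le V(Z)/\omega$, with probability at least $p$ one has $V(Z_2')\ge V(Z)/96$: OMZ is within a factor of $96$ of the offline proportional-share solution. -/

import Mathlib

open Filter Topology

noncomputable section

/-- The offline data of a budgeted procurement auction with user set `Fin n`: a non-negative monotone
submodular value function, positive costs (these are also the bids, the mechanism being truthful),
a positive budget, a deadline `T`, and the time steps `slot 0 < slot 1 < ⋯` in `{1, …, T}` at which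
users arrive, one at a time, the two halves of the time horizon receiving the two halves of the input
stream (up to rounding when `n` is odd). Which user arrives in which slot is not part of the data. -/
structure Auction (n : ℕ) where
  V : Finset (Fin n) → ℝ
  nonneg : ∀ X, 0 ≤ V X
  mono : ∀ X Y, X ⊆ Y → V X ≤ V Y
  submodular : ∀ X Y, X ⊆ Y → ∀ x, x ∉ Y → V (insert x Y) - V Y ≤ V (insert x X) - V X
  cost : Fin n → ℝ
  cost_pos : ∀ i, 0 < cost i
  B : ℝ
  B_pos : 0 < B
  T : ℕ
  slot : Fin n → ℕ
  slot_strictMono : StrictMono slot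
  slot_pos : ∀ k, 1 ≤ slot k
  slot_le : ∀ k, slot k ≤ T
  half_le : 2 * (Finset.univ.filter fun k => slot k ≤ T / 2).card ≤ n + 1
  le_half : n ≤ 2 * (Finset.univ.filter fun k => slot k ≤ T / 2).card + 1

namespace Auction

variable {n : ℕ} (I : Auction n)

/-- Marginal value `V_i(X) = V(X ∪ {i}) - V(X)`. -/
def marg (X : Finset (Fin n)) (i : Fin n) : ℝ := I.V (insert i X) - I.V X

/-- A rule `argmax_{j ∈ X \ J} V_j(J) / b_j`; the ties may be broken in any way. -/
structure ArgmaxRule where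
  pick : (X J : Finset (Fin n)) → (X \ J).Nonempty → Fin n
  pick_mem : ∀ X J h, pick X J h ∈ X \ J
  pick_max : ∀ X J h, ∀ j ∈ X \ J,
    I.marg J j / I.cost j ≤ I.marg J (pick X J h) / I.cost (pick X J h)

instance : Nonempty I.ArgmaxRule := by
  classical
  have h : ∀ (X J : Finset (Fin n)), (X \ J).Nonempty →
      ∃ i ∈ X \ J, ∀ j ∈ X \ J, I.marg J j / I.cost j ≤ I.marg J i / I.cost i :=
    fun X J hX => Finset.exists_max_image _ (fun j => I.marg J j / I.cost j) hX
  choose f hf1 hf2 using h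
  exact ⟨⟨f, hf1, hf2⟩⟩

variable {I}

/-- One pass of the loop of the proportional share rule on the users `X` with budget `b`: the user `i`
of largest marginal density is added if `b_i ≤ V_i(J) b / V(J ∪ {i})`; otherwise `J` is unchanged. -/
def shareStep (g : I.ArgmaxRule) (b : ℝ) (X J : Finset (Fin n)) : Finset (Fin n) :=
  if h : (X \ J).Nonempty then
    if I.cost (g.pick X J h) ≤ I.marg J (g.pick X J h) * b / I.V (insert (g.pick X J h) J) then
      insert (g.pick X J h) J
    else J
  else J

/-- The users selected by the proportional share rule from `X` with budget `b`. A pass that leaves `J`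
unchanged ends the loop, so `X.card` passes suffice. -/
def propShare (g : I.ArgmaxRule) (b : ℝ) (X : Finset (Fin n)) : Finset (Fin n) :=
  (shareStep g b X)^[X.card] ∅

/-- `GetDensityThreshold`: the density of the proportional share solution, divided by `δ`. -/
def densityThreshold (g : I.ArgmaxRule) (δ b : ℝ) (X : Finset (Fin n)) : ℝ :=
  I.V (propShare g b X) / b / δ

variable (I)

/-- End of the stage with (zero-based) index `k`: `⌊2 ^ k T / 2 ^ ⌊log₂ T⌋⌋`. -/
def stageEnd (k : ℕ) : ℕ := 2 ^ k * I.T / 2 ^ Nat.log 2 I.T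

/-- Budget of the stage with (zero-based) index `k`. -/
def stageBudget (k : ℕ) : ℝ := 2 ^ k * I.B / 2 ^ Nat.log 2 I.T

end Auction

/-- State of the mechanism: stage index, users seen so far, current density threshold, users selected
so far (in all stages), and the sum of the payments promised to them. -/
structure OMZState (n : ℕ) where
  stage : ℕ
  sample : Finset (Fin n)
  thr : ℝ
  sel : Finset (Fin n)
  paid : ℝ

namespace Auction

variable {n : ℕ} {I : Auction n}

/-- User `i` arrives. It is selected, at the price `V_i(S)/ρ*`, if this price is at least its bid and at
most what is left of the stage-budget. (If `ρ* = 0` the user is rejected, its bid being positive.) -/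
def arrive (s : OMZState n) (i : Fin n) : OMZState n :=
  if I.cost i ≤ I.marg s.sel i / s.thr ∧
      I.marg s.sel i / s.thr ≤ I.stageBudget s.stage - s.paid then
    { s with
      sample := insert i s.sample
      sel := insert i s.sel
      paid := s.paid + I.marg s.sel i / s.thr }
  else { s with sample := insert i s.sample }

open Classical in
/-- The arrival part of time step `t`, when user `i` arrives at time `a i`. -/
def arrivals (I : Auction n) (a : Fin n → ℕ) (t : ℕ) (s : OMZState n) : OMZState n :=
  if h : ∃ i, a i = t then arrive (I := I) s h.choose else s

/-- The end of time step `t`: if the stage ends, the threshold is recomputed from all users seen so far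
and the next stage begins. -/
def closeStage (g : I.ArgmaxRule) (δ : ℝ) (t : ℕ) (s : OMZState n) : OMZState n :=
  if t = I.stageEnd s.stage then
    { s with
      thr := densityThreshold g δ (I.stageBudget s.stage) s.sample
      stage := s.stage + 1 }
  else s

/-- The state of OMZ after `t` time steps. -/
def omzState (g : I.ArgmaxRule) (ε δ : ℝ) (a : Fin n → ℕ) : ℕ → OMZState n
  | 0 => { stage := 0, sample := ∅, thr := ε, sel := ∅, paid := 0 }
  | t + 1 => closeStage g δ (t + 1) (arrivals I a (t + 1) (omzState g ε δ a t))

/-- `Z`: the users selected by the offline proportional share mechanism. -/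
def Z (g : I.ArgmaxRule) : Finset (Fin n) := propShare g I.B Finset.univ

/-- Arrival times when user `i` is the one in position `σ i` of the input stream. -/
def arrivalTime (I : Auction n) (σ : Equiv.Perm (Fin n)) (i : Fin n) : ℕ := I.slot (σ i)

/-- The sample set at the beginning of the last stage: the users that have arrived by `⌊T/2⌋`. -/
def sampleSet (I : Auction n) (σ : Equiv.Perm (Fin n)) : Finset (Fin n) :=
  Finset.univ.filter fun i => I.arrivalTime σ i ≤ I.T / 2

/-- `Z₁'`: the proportional share solution on the sample set with stage-budget `B/2`. -/
def Z₁' (g : I.ArgmaxRule) (σ : Equiv.Perm (Fin n)) : Finset (Fin n) :=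
  propShare g (I.B / 2) (I.sampleSet σ)

/-- `Z₂'`: the set of selected users computed by OMZ when the last stage is over. -/
def Z₂' (g : I.ArgmaxRule) (ε δ : ℝ) (σ : Equiv.Perm (Fin n)) : Finset (Fin n) :=
  (omzState g ε δ (I.arrivalTime σ) I.T).sel

end Auction

open Classical in
/-- Probability of an event when the `n` users arrive in uniformly random order. -/
def orderProb {n : ℕ} (E : Equiv.Perm (Fin n) → Prop) : ℝ :=
  ((Finset.univ.filter E).card : ℝ) / (n.factorial : ℝ)

end

/-! Only the last stage matters, and its threshold is computed from the early half of the users. Put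
`v = V(Z)/ω`, a bound on every singleton value.

Sampling: on subsets of `Z`, `V` dominates a modular function that agrees with it at `Z`. Its
weights are at most `v`, and sampling without replacement is negatively correlated, so Chebyshev
puts nearly half of `V(Z)` in the early half with probability at least `3/4`
(`orderProb_sample_value`). The greedy comparison `V_le_propShare` then yields `V(Z) ≤ 7 V(Z₁')`.

Symmetry: reversing the order of arrival essentially swaps the two halves. So with probability at
least `1/2` the best late set of cost at most `B/2` is, up to `v`, as valuable as the best early
one, hence as `Z₁'` (`half_le_orderProb_bestValue`). Both events hold together with probability at
least `3/4 + 1/2 - 1 = 1/4`.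

Dichotomy (`omz_dichotomy`): at most `B/2` has been paid when the last stage begins with threshold
`ρ`, where `ρ B/2 = V(Z₁')/δ`. If some user is refused for lack of budget, the payments of this
stage certify `V(Z₂') ≥ V(Z₁')/δ - v`. Otherwise each late user has marginal value at most `ρ` times
its cost over the final selection, and comparison with the best late set gives `V(Z₂') ≥ V(Z₁') - v
- V(Z₁')/δ`. Since `v ≤ 8 V(Z₁')/ω`, the smaller bound is `secondHalfRatio`. -/

namespace Auction

variable {n : ℕ}

/-! ### Submodular inequalities and the modular minorant -/

section Submodular

variable (I : Auction n)

theorem marg_nonneg (X : Finset (Fin n)) (i : Fin n) : 0 ≤ I.marg X i :=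
  sub_nonneg.2 (I.mono _ _ (Finset.subset_insert _ _))

theorem marg_of_mem {X : Finset (Fin n)} {i : Fin n} (h : i ∈ X) : I.marg X i = 0 := by
  simp [marg, Finset.insert_eq_of_mem h]

theorem marg_anti {X Y : Finset (Fin n)} (h : X ⊆ Y) (i : Fin n) : I.marg Y i ≤ I.marg X i := by
  by_cases hi : i ∈ Y
  · rw [I.marg_of_mem hi]
    exact I.marg_nonneg X i
  · exact I.submodular X Y h i hi

theorem V_insert (X : Finset (Fin n)) (i : Fin n) : I.V (insert i X) = I.V X + I.marg X i := by
  simp [marg]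

theorem marg_le_singleton_sub (X : Finset (Fin n)) (i : Fin n) :
    I.marg X i ≤ I.V {i} - I.V ∅ := by
  simpa [marg] using I.marg_anti (Finset.empty_subset X) i

theorem marg_le_singleton (X : Finset (Fin n)) (i : Fin n) : I.marg X i ≤ I.V {i} := by
  linarith [I.marg_le_singleton_sub X i, I.nonneg ∅]

theorem V_le_add_sum_marg (J A : Finset (Fin n)) : I.V A ≤ I.V J + ∑ i ∈ A, I.marg J i := by
  suffices h : I.V (J ∪ A) ≤ I.V J + ∑ i ∈ A, I.marg J i from
    (I.mono _ _ Finset.subset_union_right).trans h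
  induction A using Finset.induction_on with
  | empty => simp
  | insert a A ha ih =>
    rw [Finset.union_insert, I.V_insert, Finset.sum_insert ha]
    linarith [I.marg_anti (Finset.subset_union_left : J ⊆ J ∪ A) a]

/-- The value of a submodular function on subsets of `Z` is bounded below by a modular function that
agrees with it at `Z`. -/
theorem exists_modular_minorant (Z : Finset (Fin n)) :
    ∃ w : Fin n → ℝ, (∀ i, 0 ≤ w i) ∧ (∀ i ∈ Z, w i ≤ I.V {i}) ∧ (∀ i ∉ Z, w i = 0) ∧
      I.V ∅ + ∑ i ∈ Z, w i = I.V Z ∧ ∀ A ⊆ Z, I.V ∅ + ∑ i ∈ A, w i ≤ I.V A := by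
  induction Z using Finset.induction_on with
  | empty =>
    refine ⟨0, by simp, by simp, by simp, by simp, fun A hA => ?_⟩
    simp [Finset.subset_empty.1 hA]
  | insert a Z ha ih =>
    obtain ⟨w, h0, h1, h2, h3, h4⟩ := ih
    have hsum : ∀ A : Finset (Fin n), a ∉ A →
        ∑ i ∈ A, Function.update w a (I.marg Z a) i = ∑ i ∈ A, w i := fun A hA =>
      Finset.sum_congr rfl fun i hi =>
        Function.update_of_ne (ne_of_mem_of_not_mem hi hA) _ _
    -- The weights are successive marginals along an enumeration of `Z`. In a subset `A` each user
    -- is added to fewer predecessors, so its marginal there can only be larger.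
    refine ⟨Function.update w a (I.marg Z a), fun i => ?_, fun i hi => ?_, fun i hi => ?_, ?_,
      fun A hA => ?_⟩
    · by_cases h : i = a
      · subst h
        simpa using I.marg_nonneg Z i
      · simpa [h] using h0 i
    · by_cases h : i = a
      · subst h
        simpa using I.marg_le_singleton Z i
      · simpa [h] using h1 i (Finset.mem_of_mem_insert_of_ne hi h)
    · rw [Finset.mem_insert, not_or] at hi
      simpa [hi.1] using h2 i hi.2
    · rw [Finset.sum_insert ha, hsum Z ha, Function.update_self, I.V_insert]
      linarith
    · by_cases haA : a ∈ A
      · have hsub : A.erase a ⊆ Z := fun i hi =>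
          Finset.mem_of_mem_insert_of_ne (hA (Finset.mem_of_mem_erase hi))
            (Finset.ne_of_mem_erase hi)
        rw [← Finset.insert_erase haA, Finset.sum_insert (Finset.notMem_erase a A),
          hsum _ (Finset.notMem_erase a A), Function.update_self, I.V_insert]
        linarith [h4 _ hsub, I.marg_anti hsub a]
      · rw [hsum A haA]
        exact h4 A ((Finset.subset_insert_iff_of_notMem haA).1 hA)

end Submodular

/-! ### Analysis of the proportional share rule -/

section ProportionalShare

variable {I : Auction n} (g : I.ArgmaxRule) (b : ℝ) (X : Finset (Fin n))

/-- What holds of the users selected so far in the loop of the proportional share rule: every other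
user has at most the average density, and the users fit into the budget. -/
structure ShareInvariant (I : Auction n) (b : ℝ) (X J : Finset (Fin n)) : Prop where
  subset : J ⊆ X
  density : ∀ j ∈ X \ J, (∑ i ∈ J, I.cost i) * I.marg J j ≤ (I.V J - I.V ∅) * I.cost j
  value_pos : J.Nonempty → 0 < I.V J
  cost_mul_le : (∑ i ∈ J, I.cost i) * I.V J ≤ (I.V J - I.V ∅) * b

/-- A remaining user is no denser than the average of `J` nor than the greedy choice `i`, hence no
denser than the average of both. For the cost bound, the density of `i` is at most the average
density of `J`, so the test passed by `i` also bounds the cost of `J`, after cancelling `b_i`. -/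
theorem ShareInvariant.step {J : Finset (Fin n)} (hJ : ShareInvariant I b X J) :
    ShareInvariant I b X (shareStep g b X J) := by
  unfold shareStep
  split_ifs with h hc
  · have hmem := Finset.mem_sdiff.1 (g.pick_mem X J h)
    have hmax := g.pick_max X J h
    have hdens := hJ.density _ (g.pick_mem X J h)
    set i := g.pick X J h
    have hci := I.cost_pos i
    -- Division by zero gives `0`, so with value `0` the test would read `b_i ≤ 0`.
    have hVpos : 0 < I.V (insert i J) := by
      refine lt_of_le_of_ne (I.nonneg _) fun h0 => ?_
      rw [← h0, div_zero] at hc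
      linarith
    rw [le_div_iff₀ hVpos] at hc
    have hcJ : 0 ≤ ∑ k ∈ J, I.cost k := Finset.sum_nonneg fun k _ => (I.cost_pos k).le
    refine ⟨Finset.insert_subset hmem.1 hJ.subset, fun j hj => ?_, fun _ => hVpos, ?_⟩
    · have hj' : j ∈ X \ J := by
        simp only [Finset.mem_sdiff, Finset.mem_insert, not_or] at hj ⊢
        exact ⟨hj.1, hj.2.2⟩
      have h1 := hJ.density j hj'
      have h2 := hmax j hj'
      rw [div_le_div_iff₀ (I.cost_pos j) hci] at h2
      have h3 := I.marg_anti (Finset.subset_insert i J) j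
      rw [Finset.sum_insert hmem.2, I.V_insert]
      have h4 := mul_le_mul_of_nonneg_left h3 (add_nonneg hci.le hcJ)
      linarith
    · rw [Finset.sum_insert hmem.2]
      have h5 : (∑ k ∈ J, I.cost k) * I.V (insert i J) ≤ (I.V J - I.V ∅) * b := by
        have hb : 0 ≤ b := by
          by_contra hb
          have := mul_pos hci hVpos
          have := mul_nonneg (I.marg_nonneg J i) (neg_nonneg.2 (not_le.1 hb).le)
          linarith
        refine le_of_mul_le_mul_left ?_ hci
        have h6 := mul_le_mul_of_nonneg_left hc hcJ
        have h7 := mul_le_mul_of_nonneg_right hdens hb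
        linarith
      have h8 := I.V_insert J i
      have h9 : I.marg J i * b = (I.V (insert i J) - I.V J) * b := by rw [h8]; ring
      linarith
  · exact hJ
  · exact hJ

theorem shareInvariant_iterate (k : ℕ) : ShareInvariant I b X ((shareStep g b X)^[k] ∅) := by
  induction k with
  | zero => exact ⟨by simp, by simp, by simp, by simp⟩
  | succ k ih =>
    rw [Function.iterate_succ_apply']
    exact ih.step g b X

theorem shareInvariant_propShare : ShareInvariant I b X (propShare g b X) :=
  shareInvariant_iterate g b X X.card

theorem cost_propShare_le (hb : 0 ≤ b) : ∑ i ∈ propShare g b X, I.cost i ≤ b := by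
  have h := shareInvariant_propShare g b X
  rcases (propShare g b X).eq_empty_or_nonempty with he | hne
  · simpa [he] using hb
  · have hV := h.value_pos hne
    refine le_of_mul_le_mul_right (h.cost_mul_le.trans ?_) hV
    nlinarith [I.nonneg ∅]

/-- Each pass reaches a fixed point or adds exactly one user, so after `X.card` passes the loop has
stopped or exhausted `X`. -/
theorem shareStep_propShare : shareStep g b X (propShare g b X) = propShare g b X := by
  have key : ∀ k, shareStep g b X ((shareStep g b X)^[k] ∅) = (shareStep g b X)^[k] ∅ ∨
      ((shareStep g b X)^[k] ∅).card = k := by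
    intro k
    induction k with
    | zero => simp
    | succ k ih =>
      rw [Function.iterate_succ_apply']
      rcases ih with ih | ih
      · exact Or.inl (by rw [ih, ih])
      · generalize (shareStep g b X)^[k] ∅ = J at ih ⊢
        by_cases h : shareStep g b X J = J
        · exact Or.inl (by rw [h, h])
        · right
          unfold shareStep at h ⊢
          split_ifs at h ⊢ with h1 h2
          · rw [Finset.card_insert_of_notMem (Finset.mem_sdiff.1 (g.pick_mem X J h1)).2, ih]
          · exact absurd rfl h
          · exact absurd rfl h
  rcases key X.card with h | h
  · exact h
  · have hX : propShare g b X = X :=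
      Finset.eq_of_subset_of_card_le (shareInvariant_propShare g b X).subset h.ge
    rw [hX]
    simp [shareStep]

/-- The proportional share rule compared with a set of users that need not fit into its budget. -/
theorem V_le_propShare {A : Finset (Fin n)} (hA : A ⊆ X) (hb : 0 < b) {v : ℝ}
    (hv : ∀ i, I.V {i} ≤ v) (hv0 : 0 ≤ v) :
    I.V A ≤ I.V (propShare g b X) +
      (∑ i ∈ A, I.cost i) * ((I.V (propShare g b X) + v) / b) := by
  have hstep := shareStep_propShare g b X
  generalize propShare g b X = J at hstep ⊢
  have hq : 0 ≤ (I.V J + v) / b := div_nonneg (add_nonneg (I.nonneg J) hv0) hb.le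
  refine (I.V_le_add_sum_marg J A).trans (add_le_add_right ?_ _)
  rw [Finset.sum_mul]
  refine Finset.sum_le_sum fun j hj => ?_
  have hcj := I.cost_pos j
  by_cases hjJ : j ∈ J
  · rw [I.marg_of_mem hjJ]
    positivity
  have hjX : j ∈ X \ J := Finset.mem_sdiff.2 ⟨hA hj, hjJ⟩
  have hne : (X \ J).Nonempty := ⟨j, hjX⟩
  have hmem := (Finset.mem_sdiff.1 (g.pick_mem X J hne)).2
  have hmax := g.pick_max X J hne j hjX
  unfold shareStep at hstep
  rw [dif_pos hne] at hstep
  split_ifs at hstep with hc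
  · exact absurd (Finset.insert_eq_self.1 hstep) hmem
  set i := g.pick X J hne
  have hci := I.cost_pos i
  -- The rejected user is the densest one outside `J`, so the bound given by its failed test applies
  -- to every user of `X \ J`.
  have hle : I.marg J i / I.cost i ≤ (I.V J + v) / b := by
    rw [div_le_div_iff₀ hci hb]
    have hVi : I.V (insert i J) ≤ I.V J + v := by
      rw [I.V_insert]
      linarith [I.marg_le_singleton J i, hv i]
    rcases (I.nonneg (insert i J)).eq_or_lt with h0 | hpos
    · have : I.marg J i = 0 :=
        le_antisymm (by linarith [I.nonneg J, I.V_insert J i]) (I.marg_nonneg J i)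
      rw [this, zero_mul]
      exact mul_nonneg (add_nonneg (I.nonneg J) hv0) hci.le
    · rw [not_le, div_lt_iff₀ hpos] at hc
      nlinarith
  have := (div_le_iff₀ hcj).1 (hmax.trans hle)
  linarith

end ProportionalShare

/-! ### Optimal sets under a budget -/

section BestValue

variable (I : Auction n)

/-- The largest value of a subset of `X` of cost at most `b`. -/
noncomputable def bestValue (b : ℝ) (X : Finset (Fin n)) : ℝ :=
  sSup (I.V '' {Y | Y ⊆ X ∧ ∑ i ∈ Y, I.cost i ≤ b})

theorem le_bestValue {b : ℝ} {X Y : Finset (Fin n)} (hY : Y ⊆ X) (hc : ∑ i ∈ Y, I.cost i ≤ b) :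
    I.V Y ≤ I.bestValue b X :=
  le_csSup (Set.toFinite _).bddAbove ⟨Y, ⟨hY, hc⟩, rfl⟩

theorem exists_bestValue {b : ℝ} (hb : 0 ≤ b) (X : Finset (Fin n)) :
    ∃ Y ⊆ X, ∑ i ∈ Y, I.cost i ≤ b ∧ I.V Y = I.bestValue b X := by
  have hne : (I.V '' {Y | Y ⊆ X ∧ ∑ i ∈ Y, I.cost i ≤ b}).Nonempty :=
    ⟨_, ∅, ⟨Finset.empty_subset X, by simpa using hb⟩, rfl⟩
  obtain ⟨Y, ⟨hY, hc⟩, h⟩ := hne.csSup_mem (Set.toFinite _)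
  exact ⟨Y, hY, hc, h⟩

theorem bestValue_mono {b : ℝ} (hb : 0 ≤ b) {X X' : Finset (Fin n)} (h : X ⊆ X') :
    I.bestValue b X ≤ I.bestValue b X' := by
  obtain ⟨Y, hY, hc, hV⟩ := I.exists_bestValue hb X
  exact hV ▸ I.le_bestValue (hY.trans h) hc

/-- Restricting an optimal set to `X'` drops at most one user and does not increase the cost. -/
theorem bestValue_le_add {b : ℝ} (hb : 0 ≤ b) {X X' : Finset (Fin n)} (h : (X \ X').card ≤ 1)
    {v : ℝ} (hv : ∀ i, I.V {i} ≤ v) (hv0 : 0 ≤ v) :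
    I.bestValue b X ≤ I.bestValue b X' + v := by
  obtain ⟨Y, hY, hc, hV⟩ := I.exists_bestValue hb X
  rw [← hV]
  have hbest : I.V (Y ∩ X') ≤ I.bestValue b X' :=
    I.le_bestValue Finset.inter_subset_right
      ((Finset.sum_le_sum_of_subset_of_nonneg Finset.inter_subset_left
        fun i _ _ => (I.cost_pos i).le).trans hc)
  by_cases hYX : Y ⊆ X'
  · rw [Finset.inter_eq_left.2 hYX] at hbest
    linarith
  · obtain ⟨x, hxY, hxX⟩ := Finset.not_subset.1 hYX
    have hsub : Y ⊆ insert x (Y ∩ X') := fun y hy => by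
      by_cases hyX : y ∈ X'
      · simp [hy, hyX]
      · have := Finset.card_le_one.1 h y (by simp [hY hy, hyX]) x (by simp [hY hxY, hxX])
        simp [this]
    have h1 := I.mono _ _ hsub
    rw [I.V_insert] at h1
    linarith [I.marg_le_singleton (Y ∩ X') x, hv x]

end BestValue

end Auction

/-! ### Uniformly random orders and second moments -/

section RandomOrder

variable {n : ℕ}

theorem orderProb_mono {E F : Equiv.Perm (Fin n) → Prop} (h : ∀ σ, E σ → F σ) :
    orderProb E ≤ orderProb F := by
  classical
  unfold orderProb
  gcongr with σ
  exact h σ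

theorem orderProb_of_forall {E : Equiv.Perm (Fin n) → Prop} (h : ∀ σ, E σ) : orderProb E = 1 := by
  have : (n.factorial : ℝ) ≠ 0 := by exact_mod_cast n.factorial_ne_zero
  simp [orderProb, h, Finset.card_univ, Fintype.card_perm, this]

theorem orderProb_not (E : Equiv.Perm (Fin n) → Prop) :
    orderProb (fun σ => ¬ E σ) = 1 - orderProb E := by
  classical
  have h0 : (n.factorial : ℝ) ≠ 0 := by exact_mod_cast n.factorial_ne_zero
  have h := Finset.card_filter_add_card_filter_not (s := (Finset.univ : Finset (Equiv.Perm (Fin n)))) E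
  rw [Finset.card_univ, Fintype.card_perm, Fintype.card_fin] at h
  have h' : ((Finset.univ.filter E).card : ℝ) + (Finset.univ.filter fun σ => ¬ E σ).card =
    n.factorial := by exact_mod_cast h
  unfold orderProb
  rw [eq_sub_iff_add_eq, ← add_div, div_eq_one_iff_eq h0, ← h', add_comm]
  congr!

theorem le_orderProb_and (E F : Equiv.Perm (Fin n) → Prop) :
    orderProb E + orderProb F - 1 ≤ orderProb fun σ => E σ ∧ F σ := by
  classical
  have h0 : (0 : ℝ) < n.factorial := by exact_mod_cast n.factorial_pos
  have h1 : orderProb (fun σ => ¬ (E σ ∧ F σ)) ≤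
      orderProb (fun σ => ¬ E σ) + orderProb (fun σ => ¬ F σ) := by
    unfold orderProb
    rw [← add_div]
    refine div_le_div_of_nonneg_right ?_ h0.le
    norm_cast
    refine (Finset.card_le_card fun σ hσ => ?_).trans (Finset.card_union_le _ _)
    simp only [Finset.mem_filter, Finset.mem_union, Finset.mem_univ, true_and] at hσ ⊢
    tauto
  rw [orderProb_not, orderProb_not, orderProb_not] at h1
  linarith

/-- An event that holds for `σ` or for `σ` followed by `τ` has probability at least one half. -/
theorem half_le_orderProb (τ : Equiv.Perm (Fin n)) {E : Equiv.Perm (Fin n) → Prop}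
    (h : ∀ σ, E σ ∨ E (τ * σ)) : 1 / 2 ≤ orderProb E := by
  classical
  have h1 : orderProb (fun σ => ¬ E σ) ≤ orderProb E := by
    unfold orderProb
    refine div_le_div_of_nonneg_right (Nat.cast_le.2 ?_) (by positivity)
    -- Left translation by `τ` injects the failures into the successes.
    refine Finset.card_le_card_of_injOn (fun σ => τ * σ) (fun σ hσ => ?_)
      (fun a _ b _ hab => mul_left_cancel hab)
    simp only [Finset.coe_filter, Finset.mem_univ, true_and, Set.mem_ofPred_eq] at hσ ⊢
    exact (h σ).resolve_left hσ
  rw [orderProb_not] at h1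
  linarith

/-- Sampling without replacement is negatively correlated. -/
theorem sum_perm_mul_nonpos {h : Fin n → ℝ} (h0 : ∑ k, h k = 0) {i j : Fin n} (hij : i ≠ j) :
    ∑ σ : Equiv.Perm (Fin n), h (σ i) * h (σ j) ≤ 0 := by
  -- By exchangeability all off-diagonal sums agree. Together with the diagonal sum, which is a sum
  -- of squares, they add up to `0`.
  have hsym : ∀ k ∈ Finset.univ.erase i, ∑ σ : Equiv.Perm (Fin n), h (σ i) * h (σ k) =
      ∑ σ : Equiv.Perm (Fin n), h (σ i) * h (σ j) := fun k hk => by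
    rw [← Equiv.sum_comp (Equiv.mulRight (Equiv.swap j k))]
    refine Finset.sum_congr rfl fun σ _ => ?_
    simp [Equiv.swap_apply_of_ne_of_ne hij (Finset.ne_of_mem_erase hk).symm]
  have hzero : ∑ k, ∑ σ : Equiv.Perm (Fin n), h (σ i) * h (σ k) = 0 := by
    rw [Finset.sum_comm]
    refine Finset.sum_eq_zero fun σ _ => ?_
    rw [← Finset.mul_sum, Equiv.sum_comp σ h, h0, mul_zero]
  rw [← Finset.add_sum_erase _ _ (Finset.mem_univ i), Finset.sum_congr rfl hsym,
    Finset.sum_const, nsmul_eq_mul] at hzero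
  have hsq : 0 ≤ ∑ σ : Equiv.Perm (Fin n), h (σ i) * h (σ i) :=
    Finset.sum_nonneg fun σ _ => mul_self_nonneg _
  have hcard : 0 < ((Finset.univ.erase i).card : ℝ) := by
    exact_mod_cast Finset.card_pos.2 ⟨j, by simp [hij.symm]⟩
  nlinarith

theorem sum_perm_sq_le {h w : Fin n → ℝ} (h0 : ∑ k, h k = 0) (h1 : ∀ k, |h k| ≤ 1)
    (hw : ∀ i, 0 ≤ w i) :
    ∑ σ : Equiv.Perm (Fin n), (∑ i, w i * h (σ i)) ^ 2 ≤ n.factorial * ∑ i, w i ^ 2 := by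
  have hexp : ∑ σ : Equiv.Perm (Fin n), (∑ i, w i * h (σ i)) ^ 2 =
      ∑ i, ∑ j, w i * w j * ∑ σ : Equiv.Perm (Fin n), h (σ i) * h (σ j) := by
    simp_rw [sq, Finset.sum_mul_sum, Finset.mul_sum]
    rw [Finset.sum_comm]
    refine Finset.sum_congr rfl fun i _ => ?_
    rw [Finset.sum_comm]
    exact Finset.sum_congr rfl fun j _ => Finset.sum_congr rfl fun σ _ => by ring
  rw [hexp, Finset.mul_sum]
  refine Finset.sum_le_sum fun i _ => ?_
  rw [← Finset.add_sum_erase _ _ (Finset.mem_univ i)]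
  have hdiag : ∑ σ : Equiv.Perm (Fin n), h (σ i) * h (σ i) ≤ n.factorial := by
    refine (Finset.sum_le_sum (g := fun _ => (1 : ℝ)) fun σ _ => ?_).trans ?_
    · have := abs_le.1 (h1 (σ i))
      nlinarith
    · simp [Finset.card_univ, Fintype.card_perm]
  have hoff : ∑ j ∈ Finset.univ.erase i,
      w i * w j * ∑ σ : Equiv.Perm (Fin n), h (σ i) * h (σ j) ≤ 0 :=
    Finset.sum_nonpos fun j hj => mul_nonpos_of_nonneg_of_nonpos (mul_nonneg (hw i) (hw j))
      (sum_perm_mul_nonpos h0 (Finset.ne_of_mem_erase hj).symm)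
  nlinarith [mul_le_mul_of_nonneg_left hdiag (mul_self_nonneg (w i))]

/-- Chebyshev's inequality for the weight of the users that arrive in the positions `P`. -/
theorem orderProb_sample_weight [NeZero n] (P : Finset (Fin n)) {w : Fin n → ℝ}
    (hw : ∀ i, 0 ≤ w i) {η : ℝ} (hη : 0 < η) :
    1 - (∑ i, w i ^ 2) / η ^ 2 ≤ orderProb fun σ =>
      (P.card / n : ℝ) * ∑ i, w i - η ≤ ∑ i, if σ i ∈ P then w i else 0 := by
  classical
  set q : ℝ := P.card / n with hq
  have hn : (0 : ℝ) < n := by exact_mod_cast Nat.pos_of_ne_zero (NeZero.ne n)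
  have hq0 : 0 ≤ q := by positivity
  have hq1 : q ≤ 1 := by
    rw [hq, div_le_one hn]
    exact_mod_cast (Finset.card_le_univ P).trans_eq (Fintype.card_fin n)
  -- The indicator of `P` is centred so that it sums to zero, as the second moment bound requires.
  set h : Fin n → ℝ := fun k => (if k ∈ P then 1 else 0) - q
  have h0 : ∑ k, h k = 0 := by
    simp only [h, Finset.sum_sub_distrib, Finset.sum_const, Finset.card_univ, Fintype.card_fin,
      nsmul_eq_mul, Finset.sum_boole, Finset.filter_univ_mem]
    rw [hq]
    field_simp
    ring
  have h1 : ∀ k, |h k| ≤ 1 := fun k => by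
    simp only [h]
    split_ifs <;> rw [abs_le] <;> constructor <;> linarith
  have hdev : ∀ σ : Equiv.Perm (Fin n),
      ∑ i, w i * h (σ i) = (∑ i, if σ i ∈ P then w i else 0) - q * ∑ i, w i := fun σ => by
    rw [Finset.mul_sum, ← Finset.sum_sub_distrib]
    refine Finset.sum_congr rfl fun i _ => ?_
    simp only [h]
    split_ifs <;> ring
  have hbad : orderProb (fun σ : Equiv.Perm (Fin n) =>
      ¬ (q * ∑ i, w i - η ≤ ∑ i, if σ i ∈ P then w i else 0)) ≤ (∑ i, w i ^ 2) / η ^ 2 := by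
    have hf : (0 : ℝ) < n.factorial := by exact_mod_cast n.factorial_pos
    unfold orderProb
    rw [div_le_div_iff₀ hf (by positivity)]
    refine le_trans ?_ ((sum_perm_sq_le h0 h1 hw).trans_eq (mul_comm _ _))
    rw [← nsmul_eq_mul, ← Finset.sum_const]
    refine (Finset.sum_le_sum (g := fun σ : Equiv.Perm (Fin n) => (∑ i, w i * h (σ i)) ^ 2)
      fun σ hσ => ?_).trans (Finset.sum_le_sum_of_subset_of_nonneg (Finset.subset_univ _) fun σ _ _ => sq_nonneg _)
    simp only [Finset.mem_filter, Finset.mem_univ, true_and, not_le] at hσ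
    simp only [hdev]
    nlinarith
  rw [orderProb_not] at hbad
  linarith

end RandomOrder

namespace Auction

variable {n : ℕ} {I : Auction n}

/-! ### Stage ends and stage budgets -/

section Stages

theorem stageEnd_log : I.stageEnd (Nat.log 2 I.T) = I.T := by
  simp [stageEnd]

theorem stageEnd_strictMono (hT : 1 ≤ I.T) : StrictMono I.stageEnd := by
  refine strictMono_nat_of_lt_succ fun k => ?_
  unfold stageEnd
  have hpos : 0 < 2 ^ Nat.log 2 I.T := by positivity
  have hle : 2 ^ Nat.log 2 I.T ≤ I.T := Nat.pow_log_le_self 2 (by omega)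
  have h1 : 1 ≤ 2 ^ k * I.T / 2 ^ Nat.log 2 I.T := by
    rw [Nat.one_le_div_iff hpos]
    exact hle.trans (Nat.le_mul_of_pos_left _ (by positivity))
  have h2 : 2 * (2 ^ k * I.T / 2 ^ Nat.log 2 I.T) ≤ 2 ^ (k + 1) * I.T / 2 ^ Nat.log 2 I.T := by
    rw [pow_succ', mul_assoc]
    exact Nat.mul_div_le_mul_div_assoc _ _ _
  omega

theorem stageEnd_of_succ_eq_log {l : ℕ} (h : Nat.log 2 I.T = l + 1) : I.stageEnd l = I.T / 2 := by
  rw [stageEnd, h, pow_succ, Nat.mul_div_mul_left _ _ (by positivity)]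

theorem stageBudget_log : I.stageBudget (Nat.log 2 I.T) = I.B := by
  simp [stageBudget]

theorem stageBudget_of_succ_eq_log {l : ℕ} (h : Nat.log 2 I.T = l + 1) :
    I.stageBudget l = I.B / 2 := by
  rw [stageBudget, h, pow_succ]
  field_simp

theorem stageBudget_le_succ (k : ℕ) : I.stageBudget k ≤ I.stageBudget (k + 1) := by
  unfold stageBudget
  have := I.B_pos
  gcongr <;> simp

theorem stageBudget_nonneg (k : ℕ) : 0 ≤ I.stageBudget k := by
  have := I.B_pos
  unfold stageBudget
  positivity

end Stages

/-! ### Invariants of the mechanism -/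

section Mechanism

variable (g : I.ArgmaxRule) (ε δ : ℝ) {a : Fin n → ℕ}

theorem arrivals_apply (ha : Function.Injective a) (s : OMZState n) (i : Fin n) :
    arrivals I a (a i) s = arrive (I := I) s i := by
  have h : ∃ j, a j = a i := ⟨i, rfl⟩
  rw [arrivals, dif_pos h, ha h.choose_spec]

theorem arrivals_cases (a : Fin n → ℕ) (t : ℕ) (s : OMZState n) :
    arrivals I a t s = s ∨ ∃ i, arrivals I a t s = arrive (I := I) s i := by
  unfold arrivals
  split_ifs with h
  · exact Or.inr ⟨_, rfl⟩
  · exact Or.inl rfl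

theorem arrive_cases (s : OMZState n) (i : Fin n) :
    ((arrive (I := I) s i).sel = s.sel ∧ (arrive (I := I) s i).paid = s.paid) ∨
    ((arrive (I := I) s i).sel = insert i s.sel ∧
      (arrive (I := I) s i).paid = s.paid + I.marg s.sel i / s.thr ∧
      I.marg s.sel i / s.thr ≤ I.stageBudget s.stage - s.paid) := by
  unfold arrive
  split_ifs with h
  · exact Or.inr ⟨rfl, rfl, h.2⟩
  · exact Or.inl ⟨rfl, rfl⟩

theorem arrive_stage (s : OMZState n) (i : Fin n) : (arrive (I := I) s i).stage = s.stage := by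
  unfold arrive; split_ifs <;> rfl

theorem arrive_thr (s : OMZState n) (i : Fin n) : (arrive (I := I) s i).thr = s.thr := by
  unfold arrive; split_ifs <;> rfl

theorem arrive_sample (s : OMZState n) (i : Fin n) :
    (arrive (I := I) s i).sample = insert i s.sample := by
  unfold arrive; split_ifs <;> rfl

theorem arrivals_stage (a : Fin n → ℕ) (t : ℕ) (s : OMZState n) :
    (arrivals I a t s).stage = s.stage := by
  rcases arrivals_cases a t s with h | ⟨i, h⟩ <;> rw [h]
  exact arrive_stage s i

theorem arrivals_thr (a : Fin n → ℕ) (t : ℕ) (s : OMZState n) :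
    (arrivals I a t s).thr = s.thr := by
  rcases arrivals_cases a t s with h | ⟨i, h⟩ <;> rw [h]
  exact arrive_thr s i

theorem closeStage_sel (t : ℕ) (s : OMZState n) : (closeStage g δ t s).sel = s.sel := by
  unfold closeStage; split_ifs <;> rfl

theorem closeStage_sample (t : ℕ) (s : OMZState n) :
    (closeStage g δ t s).sample = s.sample := by
  unfold closeStage; split_ifs <;> rfl

theorem mem_arrivals_sample (ha : Function.Injective a) (t : ℕ) (s : OMZState n) (j : Fin n) :
    j ∈ (arrivals I a t s).sample ↔ j ∈ s.sample ∨ a j = t := by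
  by_cases h : ∃ i, a i = t
  · obtain ⟨i, rfl⟩ := h
    rw [arrivals_apply ha, arrive_sample, Finset.mem_insert, or_comm, ha.eq_iff]
  · rw [arrivals, dif_neg h]
    exact ⟨Or.inl, fun h' => h'.resolve_right fun h'' => h ⟨j, h''⟩⟩

theorem mem_omzState_sample (ha : Function.Injective a) (hpos : ∀ i, 1 ≤ a i) (t : ℕ) (j : Fin n) :
    j ∈ (omzState g ε δ a t).sample ↔ a j ≤ t := by
  induction t with
  | zero =>
    have := hpos j
    simp only [omzState, Finset.notMem_empty, false_iff]
    omega
  | succ t ih =>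
    rw [omzState, closeStage_sample, mem_arrivals_sample ha, ih]
    omega

/-- The inequality `t < stageEnd` is strict because a stage ending at `t` is closed within step `t`.
The two conditions determine the stage. -/
theorem omzState_stage_spec (hT : 1 ≤ I.T) (a : Fin n → ℕ) (t : ℕ) :
    t < I.stageEnd (omzState g ε δ a t).stage ∧
      ∀ j < (omzState g ε δ a t).stage, I.stageEnd j ≤ t := by
  have hmono := stageEnd_strictMono hT
  induction t with
  | zero =>
    refine ⟨?_, by simp [omzState]⟩
    simp only [omzState, stageEnd, pow_zero, one_mul]
    exact Nat.div_pos (Nat.pow_log_le_self 2 (by omega)) (by positivity)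
  | succ t ih =>
    rw [omzState, closeStage, arrivals_stage]
    generalize hk : (omzState g ε δ a t).stage = k at ih
    split_ifs with h
    · refine ⟨h.trans_lt (hmono k.lt_succ_self), fun j hj => ?_⟩
      exact (hmono.monotone (Nat.lt_succ_iff.1 hj)).trans h.ge
    · rw [arrivals_stage, hk]
      exact ⟨by omega, fun j hj => (ih.2 j hj).trans t.le_succ⟩

theorem omzState_stage_eq (hT : 1 ≤ I.T) (a : Fin n → ℕ) {t k : ℕ} (h1 : t < I.stageEnd k)
    (h2 : ∀ j < k, I.stageEnd j ≤ t) : (omzState g ε δ a t).stage = k := by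
  obtain ⟨h3, h4⟩ := omzState_stage_spec g ε δ hT a t
  rcases lt_trichotomy (omzState g ε δ a t).stage k with h | h | h
  · exact absurd (h2 _ h) (not_le.2 h3)
  · exact h
  · exact absurd (h4 _ h) (not_le.2 h1)

theorem omzState_sel_subset_succ (a : Fin n → ℕ) (t : ℕ) :
    (omzState g ε δ a t).sel ⊆ (omzState g ε δ a (t + 1)).sel := by
  rw [omzState, closeStage_sel]
  rcases arrivals_cases a (t + 1) (omzState g ε δ a t) with h | ⟨i, h⟩ <;> rw [h]
  rcases arrive_cases (omzState g ε δ a t) i with h' | h' <;> rw [h'.1]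
  exact Finset.subset_insert _ _

theorem omzState_sel_mono (a : Fin n → ℕ) : Monotone fun t => (omzState g ε δ a t).sel :=
  monotone_nat_of_le_succ (omzState_sel_subset_succ g ε δ a)

theorem arrivals_paid_le (a : Fin n → ℕ) (t : ℕ) {s : OMZState n}
    (h : s.paid ≤ I.stageBudget s.stage) : (arrivals I a t s).paid ≤ I.stageBudget s.stage := by
  rcases arrivals_cases a t s with h' | ⟨i, h'⟩ <;> rw [h']
  · exact h
  rcases arrive_cases s i with h'' | h''
  · exact h''.2.trans_le h
  · linarith [h''.2.1, h''.2.2]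

theorem omzState_paid_le (a : Fin n → ℕ) (t : ℕ) :
    (omzState g ε δ a t).paid ≤ I.stageBudget (omzState g ε δ a t).stage := by
  induction t with
  | zero => exact stageBudget_nonneg 0
  | succ t ih =>
    have h := arrivals_paid_le a (t + 1) ih
    rw [omzState, closeStage]
    split_ifs with hc
    · simp only [arrivals_stage]
      exact h.trans (stageBudget_le_succ _)
    · rwa [arrivals_stage]

/-- The state at the beginning of the last stage. -/
theorem omzState_half (hT : 2 ≤ I.T) (a : Fin n → ℕ) :
    (omzState g ε δ a (I.T / 2)).thr =
        I.V (propShare g (I.B / 2) (omzState g ε δ a (I.T / 2)).sample) / (I.B / 2) / δ ∧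
      (omzState g ε δ a (I.T / 2)).paid ≤ I.B / 2 := by
  obtain ⟨l, hl⟩ : ∃ l, Nat.log 2 I.T = l + 1 :=
    ⟨Nat.log 2 I.T - 1, by have := Nat.log_pos one_lt_two hT; omega⟩
  obtain ⟨t, ht⟩ : ∃ t, I.T / 2 = t + 1 := ⟨I.T / 2 - 1, by omega⟩
  have hend : I.stageEnd l = t + 1 := (stageEnd_of_succ_eq_log hl).trans ht
  have hmono := stageEnd_strictMono (I := I) (by omega)
  have hstage : (omzState g ε δ a t).stage = l :=
    omzState_stage_eq g ε δ (by omega) a (by omega) fun j hj => by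
      have := hmono hj
      omega
  -- The payments are bounded before the stage closes, while its budget is still `B/2`; afterwards
  -- the stage budget is `B`.
  have hpaid := arrivals_paid_le a (t + 1) (omzState_paid_le g ε δ a t)
  rw [hstage, stageBudget_of_succ_eq_log hl] at hpaid
  rw [ht, omzState, closeStage, arrivals_stage, hstage, if_pos hend.symm]
  exact ⟨by rw [stageBudget_of_succ_eq_log hl, densityThreshold], hpaid⟩

theorem omzState_stage_last (hT : 2 ≤ I.T) (a : Fin n → ℕ) {t : ℕ} (h1 : I.T / 2 ≤ t)
    (h2 : t < I.T) : (omzState g ε δ a t).stage = Nat.log 2 I.T := by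
  obtain ⟨l, hl⟩ : ∃ l, Nat.log 2 I.T = l + 1 :=
    ⟨Nat.log 2 I.T - 1, by have := Nat.log_pos one_lt_two hT; omega⟩
  refine omzState_stage_eq g ε δ (by omega) a (by rwa [stageEnd_log]) fun j hj => ?_
  rw [hl] at hj
  exact ((stageEnd_strictMono (by omega)).monotone (Nat.lt_succ_iff.1 hj)).trans
    ((stageEnd_of_succ_eq_log hl).trans_le h1)

/-- During the last stage the threshold is constant, and the payments beyond half of the budget are
backed by value at the rate of the threshold. -/
theorem omzState_last (hT : 2 ≤ I.T) (a : Fin n → ℕ) {ρ : ℝ} (hρ : 0 < ρ)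
    (hthr : (omzState g ε δ a (I.T / 2)).thr = ρ) {t : ℕ} (h1 : I.T / 2 ≤ t) (h2 : t < I.T) :
    (omzState g ε δ a t).thr = ρ ∧
      ρ * ((omzState g ε δ a t).paid - I.B / 2) ≤ I.V (omzState g ε δ a t).sel := by
  induction t, h1 using Nat.le_induction with
  | base =>
    refine ⟨hthr, le_trans ?_ (I.nonneg _)⟩
    have := (omzState_half g ε δ hT a).2
    exact mul_nonpos_of_nonneg_of_nonpos hρ.le (by linarith)
  | succ t h1 ih =>
    obtain ⟨ih1, ih2⟩ := ih (by omega)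
    have hstage := omzState_stage_last g ε δ hT a h1 (by omega)
    rw [omzState, closeStage, arrivals_stage, hstage, stageEnd_log, if_neg (by omega),
      arrivals_thr]
    refine ⟨ih1, ?_⟩
    rcases arrivals_cases a (t + 1) (omzState g ε δ a t) with h | ⟨i, h⟩ <;> rw [h]
    · exact ih2
    rcases arrive_cases (omzState g ε δ a t) i with ⟨hs, hp⟩ | ⟨hs, hp, -⟩ <;> rw [hs, hp]
    · exact ih2
    · rw [ih1, I.V_insert]
      have : ρ * (I.marg (omzState g ε δ a t).sel i / ρ) = I.marg (omzState g ε δ a t).sel i :=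
        mul_div_cancel₀ _ hρ.ne'
      linarith

/-- Either the last stage exhausts its budget, or every user arriving in it that is not selected has
density below the threshold. -/
theorem omz_dichotomy (hT : 2 ≤ I.T) (ha : Function.Injective a) {ρ : ℝ} (hρ : 0 < ρ)
    (hthr : (omzState g ε δ a (I.T / 2)).thr = ρ) {v : ℝ} (hv : ∀ i, I.V {i} ≤ v)
    {A : Finset (Fin n)} (hA : ∀ i ∈ A, I.T / 2 < a i ∧ a i ≤ I.T) :
    ρ * (I.B / 2) - v ≤ I.V (omzState g ε δ a I.T).sel ∨
      I.V A ≤ I.V (omzState g ε δ a I.T).sel + ρ * ∑ i ∈ A, I.cost i := by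
  by_contra! hcon
  obtain ⟨hcon1, hcon2⟩ := hcon
  refine absurd (I.V_le_add_sum_marg (omzState g ε δ a I.T).sel A) (not_le.2 ?_)
  refine lt_of_le_of_lt (add_le_add_right ?_ _) hcon2
  rw [Finset.mul_sum]
  refine Finset.sum_le_sum fun i hi => ?_
  obtain ⟨h1, h2⟩ := hA i hi
  -- The decision about `i` is made in the state after `t` steps. Its marginal there bounds the one
  -- over the final selection.
  obtain ⟨t, ht⟩ : ∃ t, a i = t + 1 := ⟨a i - 1, by omega⟩
  have hstage := omzState_stage_last g ε δ hT a (t := t) (by omega) (by omega)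
  obtain ⟨hthr', hval⟩ := omzState_last g ε δ hT a hρ hthr (t := t) (by omega) (by omega)
  have hsub : (omzState g ε δ a t).sel ⊆ (omzState g ε δ a I.T).sel :=
    omzState_sel_mono g ε δ a (show t ≤ I.T by omega)
  have hsub' : (omzState g ε δ a (t + 1)).sel ⊆ (omzState g ε δ a I.T).sel :=
    omzState_sel_mono g ε δ a (show t + 1 ≤ I.T by omega)
  rw [omzState, closeStage_sel, ← ht, arrivals_apply ha, arrive, hthr', hstage, stageBudget_log]
    at hsub'
  have hci := I.cost_pos i
  split_ifs at hsub' with hc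
  · rw [I.marg_of_mem (hsub' (Finset.mem_insert_self _ _))]
    positivity
  · refine (I.marg_anti hsub i).trans ?_
    rw [not_and_or, not_le, not_le, div_lt_iff₀ hρ, lt_div_iff₀ hρ] at hc
    rcases hc with hc | hc
    · linarith
    -- Refusal for lack of budget means `ρ (B - paid) < V_i(S) ≤ v`. Adding `ρ (paid - B/2) ≤ V(S)`
    -- gives `ρ B/2 - v < V(S)`, the first alternative.
    · have := I.marg_le_singleton (omzState g ε δ a t).sel i
      have := I.mono _ _ hsub
      linarith [hv i]

end Mechanism

end Auction

/-! ### The early and the late half of the users -/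

namespace Auction

variable {n : ℕ} {I : Auction n}

/-- The positions of the input stream that belong to the first half of the time horizon. -/
def earlySlots (I : Auction n) : Finset (Fin n) := Finset.univ.filter fun k => I.slot k ≤ I.T / 2

theorem mem_earlySlots {k : Fin n} : k ∈ I.earlySlots ↔ I.slot k ≤ I.T / 2 := by
  simp [earlySlots]

theorem mem_sampleSet {σ : Equiv.Perm (Fin n)} {i : Fin n} :
    i ∈ I.sampleSet σ ↔ σ i ∈ I.earlySlots := by
  rw [mem_earlySlots, sampleSet, Finset.mem_filter]
  simp [arrivalTime]

theorem arrivalTime_injective (σ : Equiv.Perm (Fin n)) : Function.Injective (I.arrivalTime σ) :=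
  I.slot_strictMono.injective.comp σ.injective

/-- At most one position is, like its mirror image, in the first half of the time horizon. -/
theorem card_earlySlots_inter_rev_le :
    (I.earlySlots.filter fun k => k.rev ∈ I.earlySlots).card ≤ 1 := by
  -- The early positions form an initial segment of length at most `(n + 1) / 2`, so only the middle
  -- position can be early along with its mirror image.
  have key : ∀ k : Fin n, k ∈ I.earlySlots → 2 * ((k : ℕ) + 1) ≤ n + 1 := fun k hk => by
    refine le_trans ?_ I.half_le
    have hsub : Finset.Iic k ⊆ I.earlySlots := fun l hl => by
      rw [mem_earlySlots] at hk ⊢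
      exact (I.slot_strictMono.monotone (Finset.mem_Iic.1 hl)).trans hk
    have := Finset.card_le_card hsub
    rw [Fin.card_Iic] at this
    exact Nat.mul_le_mul_left 2 this
  refine Finset.card_le_one.2 fun k hk l hl => ?_
  rw [Finset.mem_filter] at hk hl
  have h1 := key _ hk.1
  have h2 := key _ hk.2
  have h3 := key _ hl.1
  have h4 := key _ hl.2
  rw [Fin.val_rev] at h2 h4
  ext
  omega

/-- The half of the users that arrives late is, with probability at least one half, about as good
as the half that arrives early. -/
theorem half_le_orderProb_bestValue (I : Auction n) {b v : ℝ} (hb : 0 ≤ b)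
    (hv : ∀ i, I.V {i} ≤ v) (hv0 : 0 ≤ v) :
    1 / 2 ≤ orderProb fun σ =>
      I.bestValue b (I.sampleSet σ) ≤ I.bestValue b (I.sampleSet σ)ᶜ + v := by
  -- `D σ` omits at most one early user, and under the reversed order it consists of late users of
  -- `σ`. Comparing `D σ` with `D (Fin.revPerm * σ)` is thus exactly symmetric, even for odd `n`.
  set D : Equiv.Perm (Fin n) → Finset (Fin n) := fun σ =>
    Finset.univ.filter fun i => σ i ∈ I.earlySlots ∧ (σ i).rev ∉ I.earlySlots with hD
  have hearly : ∀ σ, I.bestValue b (I.sampleSet σ) ≤ I.bestValue b (D σ) + v := fun σ => by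
    refine I.bestValue_le_add hb ?_ hv hv0
    refine le_trans ?_ (card_earlySlots_inter_rev_le (I := I))
    refine Finset.card_le_card_of_injOn σ (fun i hi => ?_) σ.injective.injOn
    simp only [hD, Finset.coe_sdiff, Finset.coe_filter, Finset.mem_univ, true_and, Set.mem_sdiff,
      Finset.mem_coe, mem_sampleSet, Set.mem_ofPred_eq, not_and, not_not] at hi ⊢
    exact ⟨hi.1, hi.2 hi.1⟩
  have hlate : ∀ σ, I.bestValue b (D (Fin.revPerm * σ)) ≤ I.bestValue b (I.sampleSet σ)ᶜ :=
    fun σ => I.bestValue_mono hb fun i hi => by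
      simp only [hD, Finset.mem_filter, Finset.mem_univ, true_and, Equiv.Perm.coe_mul,
        Function.comp_apply, Fin.revPerm_apply, Fin.rev_rev] at hi
      simpa [mem_sampleSet] using hi.2
  refine (half_le_orderProb Fin.revPerm
    (E := fun σ => I.bestValue b (D σ) ≤ I.bestValue b (D (Fin.revPerm * σ))) fun σ => ?_).trans
    (orderProb_mono fun σ hσ => ?_)
  · have : (Fin.revPerm * (Fin.revPerm * σ) : Equiv.Perm (Fin n)) = σ := by ext; simp
    rw [this]
    exact le_total _ _
  · linarith [hearly σ, hlate σ]

/-- The number of users in a market in which every user is small. -/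
theorem le_card_of_small [NeZero n] (I : Auction n) {ω : ℝ} (hω : 0 < ω) {Z : Finset (Fin n)}
    (hZ : 0 < I.V Z) (hsmall : ∀ i, I.V {i} ≤ I.V Z / ω) : ω ≤ n := by
  have h1 : I.V Z ≤ n * (I.V Z / ω) := by
    -- Expanding around a singleton instead of `∅` leaves `n` terms, with no extra `V ∅`.
    refine (I.mono _ _ (Finset.subset_univ Z)).trans
      ((I.V_le_add_sum_marg {0} Finset.univ).trans ?_)
    rw [← Finset.add_sum_erase _ _ (Finset.mem_univ (0 : Fin n)),
      I.marg_of_mem (Finset.mem_singleton_self 0), zero_add]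
    have h2 : ∑ i ∈ Finset.univ.erase (0 : Fin n), I.marg {0} i ≤
        ∑ i ∈ Finset.univ.erase (0 : Fin n), I.V Z / ω :=
      Finset.sum_le_sum fun i _ => (I.marg_le_singleton _ i).trans (hsmall i)
    have h3 : (n : ℝ) * (I.V Z / ω) = ∑ i : Fin n, I.V Z / ω := by simp
    rw [h3, ← Finset.add_sum_erase _ _ (Finset.mem_univ (0 : Fin n))]
    exact add_le_add (hsmall 0) h2
  rw [mul_div_assoc', le_div_iff₀ hω, mul_comm (n : ℝ)] at h1
  exact le_of_mul_le_mul_left h1 hZ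

/-- The part of `Z` that arrives early is, with probability at least `3 / 4`, of nearly half its value. -/
theorem orderProb_sample_value [NeZero n] (I : Auction n) {ω : ℝ} (hω : 10000 ≤ ω)
    {Z : Finset (Fin n)} (hZ : 0 < I.V Z) (hsmall : ∀ i, I.V {i} ≤ I.V Z / ω) :
    3 / 4 ≤ orderProb fun σ => 47 / 100 * I.V Z ≤ I.V (Z ∩ I.sampleSet σ) := by
  have hω0 : 0 < ω := by linarith
  have hn := I.le_card_of_small hω0 hZ hsmall
  obtain ⟨w, w0, w1, w2, w3, w4⟩ := I.exists_modular_minorant Z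
  have hsumw : ∑ i, w i = I.V Z - I.V ∅ := by
    rw [← w3, add_sub_cancel_left]
    exact (Finset.sum_subset (Finset.subset_univ Z) fun i _ hi => w2 i hi).symm
  have hsq : ∑ i, w i ^ 2 ≤ I.V Z / ω * I.V Z := by
    have hle : ∀ i, w i ^ 2 ≤ I.V Z / ω * w i := fun i => by
      rw [sq]
      refine mul_le_mul_of_nonneg_right ?_ (w0 i)
      by_cases hi : i ∈ Z
      · exact (w1 i hi).trans (hsmall i)
      · rw [w2 i hi]
        positivity
    refine (Finset.sum_le_sum fun i _ => hle i).trans ?_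
    rw [← Finset.mul_sum, hsumw]
    exact mul_le_mul_of_nonneg_left (by linarith [I.nonneg ∅]) (by positivity)
  -- With this deviation Chebyshev fails with probability at most `2500/ω ≤ 1/4`. The early fraction
  -- is at least `0.49` because `n ≥ ω`, and `0.49 - 1/50 = 0.47`.
  have hη : 0 < I.V Z / 50 := by positivity
  refine le_trans ?_ ((orderProb_sample_weight I.earlySlots w0 hη).trans
    (orderProb_mono fun σ hσ => ?_))
  · have : (∑ i, w i ^ 2) / (I.V Z / 50) ^ 2 ≤ 1 / 4 := by
      rw [div_le_iff₀ (by positivity)]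
      refine hsq.trans ?_
      rw [div_mul_eq_mul_div, div_le_iff₀ hω0]
      nlinarith [mul_pos hZ hZ]
    linarith
  · have hsum : ∑ i, (if σ i ∈ I.earlySlots then w i else 0) = ∑ i ∈ Z ∩ I.sampleSet σ, w i := by
      rw [← Finset.sum_filter]
      refine (Finset.sum_subset (fun i hi => ?_) fun i hi hi' => ?_).symm
      · simpa [mem_sampleSet] using (Finset.mem_inter.1 hi).2
      · refine w2 i fun hiZ => hi' (Finset.mem_inter.2 ⟨hiZ, ?_⟩)
        simpa [mem_sampleSet] using hi
    have hmin := w4 _ (Finset.inter_subset_left (s₁ := Z) (s₂ := I.sampleSet σ))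
    rw [hsum, hsumw] at hσ
    have hcard : (n : ℝ) ≤ 2 * I.earlySlots.card + 1 := by exact_mod_cast I.le_half
    have hcard' : (I.earlySlots.card : ℝ) ≤ n := by
      exact_mod_cast (Finset.card_le_univ I.earlySlots).trans_eq (Fintype.card_fin n)
    have hn0 : (0 : ℝ) < n := by linarith
    have hq : 49 / 100 ≤ (I.earlySlots.card : ℝ) / n := by
      rw [le_div_iff₀ hn0]
      linarith
    have hq' : (I.earlySlots.card : ℝ) / n ≤ 1 := (div_le_one hn0).2 hcard'
    have hV0 := I.nonneg ∅
    nlinarith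

/-- The proportional share rule with half of the budget, applied to a sample holding nearly half of
the value of `Z`. -/
theorem V_le_seven_mul_propShare {g₀ g : I.ArgmaxRule} {X : Finset (Fin n)} {ω : ℝ}
    (hω : 10000 ≤ ω) (hsmall : ∀ i, I.V {i} ≤ I.V (Z g₀) / ω)
    (hX : 47 / 100 * I.V (Z g₀) ≤ I.V (Z g₀ ∩ X)) :
    I.V (Z g₀) ≤ 7 * I.V (propShare g (I.B / 2) X) := by
  have hB := I.B_pos
  have hω0 : 0 < ω := by linarith
  have hZ := I.nonneg (Z g₀)
  have hv0 : 0 ≤ I.V (Z g₀) / ω := by positivity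
  have hv1 : I.V (Z g₀) / ω ≤ I.V (Z g₀) / 10000 := by gcongr
  have h1 := V_le_propShare g (I.B / 2) X (Finset.inter_subset_right (s₁ := Z g₀))
    (by positivity) hsmall hv0
  set x := I.V (propShare g (I.B / 2) X)
  have hx : 0 ≤ x := I.nonneg _
  have hcost : ∑ i ∈ Z g₀ ∩ X, I.cost i ≤ I.B :=
    (Finset.sum_le_sum_of_subset_of_nonneg Finset.inter_subset_left
      fun i _ _ => (I.cost_pos i).le).trans (cost_propShare_le g₀ I.B _ hB.le)
  -- The comparison set may cost twice the budget `B/2`, whence the factor `2`. So `0.47 V(Z) ≤ 3x +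
  -- 2 V(Z)/ω`, which leaves room for the constant `7`.
  have h2 : (∑ i ∈ Z g₀ ∩ X, I.cost i) * ((x + I.V (Z g₀) / ω) / (I.B / 2)) ≤
      2 * (x + I.V (Z g₀) / ω) := by
    refine (mul_le_mul_of_nonneg_right hcost (by positivity)).trans_eq ?_
    field_simp
  linarith

/-! ### The competitive ratio and the combination of the events -/

/-- The competitive ratio of the second half of OMZ relative to its sample. -/
noncomputable def secondHalfRatio (ω δ : ℝ) : ℝ := min (1 / δ - 8 / ω) (1 - 8 / ω - 1 / δ)

theorem secondHalfRatio_eventually_ge {δ : ℝ} (hδ : 8 < δ) :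
    ∀ᶠ ω in atTop, 1 / (2 * δ) ≤ secondHalfRatio ω δ := by
  have h0 : (0 : ℝ) < 1 / (2 * δ) := by positivity
  have hlim : Tendsto (fun ω : ℝ => 8 / ω) atTop (𝓝 0) := tendsto_const_nhds.div_atTop tendsto_id
  filter_upwards [hlim.eventually_lt_const h0] with ω hω
  have h1 : 1 / δ = 1 / (2 * δ) + 1 / (2 * δ) := by field_simp; norm_num
  have h2 : 1 / δ ≤ 1 / 8 := one_div_le_one_div_of_le (by norm_num) hδ.le
  exact le_min (by linarith) (by linarith)

theorem tendsto_secondHalfRatio :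
    Tendsto (fun q : ℝ × ℝ => secondHalfRatio q.1 q.2) (atTop ×ˢ 𝓝 12) (𝓝 (1 / 12)) := by
  have h1 : Tendsto (fun q : ℝ × ℝ => 8 / q.1) (atTop ×ˢ 𝓝 (12 : ℝ)) (𝓝 0) :=
    tendsto_const_nhds.div_atTop tendsto_fst
  have h2 : Tendsto (fun q : ℝ × ℝ => 1 / q.2) (atTop ×ˢ 𝓝 (12 : ℝ)) (𝓝 (1 / 12)) :=
    tendsto_const_nhds.div tendsto_snd (by norm_num)
  have h := (h2.sub h1).min ((tendsto_const_nhds (x := (1 : ℝ)).sub h1).sub h2)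
  have hmin : min (1 / 12 - 0) (1 - 0 - 1 / 12) = (1 / 12 : ℝ) := by
    rw [min_eq_left] <;> norm_num
  rwa [hmin] at h

theorem secondHalfRatio_le_one {ω δ : ℝ} (hω : 0 < ω) (hδ : 1 < δ) : secondHalfRatio ω δ ≤ 1 := by
  have h1 : 0 < 8 / ω := by positivity
  have h2 : 0 < 1 / δ := by positivity
  exact (min_le_right _ _).trans (by linarith)

/-- The dichotomy is applied to an optimal late set `A` of cost at most `B/2`; its two alternatives
give the two entries of the minimum. -/
theorem secondHalfRatio_mul_le (g : I.ArgmaxRule) {ω δ ε v : ℝ} {σ : Equiv.Perm (Fin n)}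
    (hT : 2 ≤ I.T) (hδ : 1 < δ) (hv : ∀ i, I.V {i} ≤ v)
    (hpos : 0 < I.V (Z₁' g σ)) (hvZ : v ≤ 8 / ω * I.V (Z₁' g σ))
    (hbest : I.bestValue (I.B / 2) (I.sampleSet σ) ≤
      I.bestValue (I.B / 2) (I.sampleSet σ)ᶜ + v) :
    secondHalfRatio ω δ * I.V (Z₁' g σ) ≤ I.V (Z₂' g ε δ σ) := by
  have hB : 0 < I.B / 2 := half_pos I.B_pos
  have ha := I.arrivalTime_injective σ
  have hsample : (omzState g ε δ (I.arrivalTime σ) (I.T / 2)).sample = I.sampleSet σ := by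
    ext i
    rw [mem_omzState_sample g ε δ ha fun i => I.slot_pos _]
    simp [sampleSet]
  have hthr := (omzState_half g ε δ hT (I.arrivalTime σ)).1
  rw [hsample] at hthr
  change _ = I.V (Z₁' g σ) / (I.B / 2) / δ at hthr
  obtain ⟨A, hA, hcost, hVA⟩ := I.exists_bestValue hB.le (I.sampleSet σ)ᶜ
  have hle : I.V (Z₁' g σ) ≤ I.bestValue (I.B / 2) (I.sampleSet σ) :=
    I.le_bestValue (shareInvariant_propShare g _ _).subset (cost_propShare_le g _ _ hB.le)
  have hρ : 0 < I.V (Z₁' g σ) / (I.B / 2) / δ := by positivity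
  have hρB : I.V (Z₁' g σ) / (I.B / 2) / δ * (I.B / 2) = 1 / δ * I.V (Z₁' g σ) := by
    rw [div_right_comm, div_mul_cancel₀ _ hB.ne', one_div_mul_eq_div]
  have hlate : ∀ i ∈ A, I.T / 2 < I.arrivalTime σ i ∧ I.arrivalTime σ i ≤ I.T := fun i hi => by
    have := hA hi
    simp only [sampleSet, Finset.mem_compl, Finset.mem_filter, Finset.mem_univ, true_and,
      not_le] at this
    exact ⟨this, I.slot_le _⟩
  rcases omz_dichotomy g ε δ hT ha hρ hthr hv hlate with h | h
  · refine (mul_le_mul_of_nonneg_right (min_le_left _ _) hpos.le).trans ?_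
    unfold Z₂'
    linarith
  · refine (mul_le_mul_of_nonneg_right (min_le_right _ _) hpos.le).trans ?_
    have := mul_le_mul_of_nonneg_left hcost hρ.le
    unfold Z₂'
    linarith

/-- OMZ in the secretary model: the sample solution and the users selected in the second half. -/
theorem quarter_le_orderProb_omz (I : Auction n) (ε : ℝ) {ω δ : ℝ} (hω : 10000 ≤ ω) (hδ : 1 < δ)
    (g₀ : I.ArgmaxRule) (g : Equiv.Perm (Fin n) → I.ArgmaxRule)
    (hsmall : ∀ i, I.V {i} ≤ I.V (Z g₀) / ω) :
    1 / 4 ≤ orderProb fun σ =>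
      I.V (Z g₀) ≤ 7 * I.V (Z₁' (g σ) σ) ∧
      secondHalfRatio ω δ * I.V (Z₁' (g σ) σ) ≤ I.V (Z₂' (g σ) ε δ σ) := by
  have hω0 : 0 < ω := by linarith
  have hr := secondHalfRatio_le_one hω0 hδ
  rcases Nat.eq_zero_or_pos n with rfl | hn
  · rw [orderProb_of_forall]
    · norm_num
    intro σ
    have h1 : Z g₀ = Z₁' (g σ) σ := Subsingleton.elim _ _
    have h2 : Z₂' (g σ) ε δ σ = Z₁' (g σ) σ := Subsingleton.elim _ _
    have h3 := I.nonneg (Z₁' (g σ) σ)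
    rw [h1, h2]
    exact ⟨by linarith, mul_le_of_le_one_left h3 hr⟩
  have : NeZero n := ⟨hn.ne'⟩
  rcases (I.nonneg (Z g₀)).eq_or_lt with hZ | hZ
  · rw [← hZ, zero_div] at hsmall
    have hzero : ∀ X, I.V X = 0 := fun X => by
      refine le_antisymm ((I.V_le_add_sum_marg {0} X).trans ?_) (I.nonneg X)
      exact add_nonpos (hsmall 0)
        (Finset.sum_nonpos fun i _ => (I.marg_le_singleton _ i).trans (hsmall i))
    rw [orderProb_of_forall]
    · norm_num
    · simp [hzero]
  -- Small users force `n ≥ ω`, and distinct slots force `T ≥ n`; so there is a stage before the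
  -- last one to set the threshold.
  have hT : 2 ≤ I.T := by
    have h1 : (10000 : ℝ) ≤ n := hω.trans (I.le_card_of_small hω0 hZ hsmall)
    have h2 : 10000 ≤ n := by exact_mod_cast h1
    have h3 : n ≤ I.T := by
      have := Finset.card_le_card_of_injOn (s := Finset.univ) (t := Finset.Icc 1 I.T) I.slot
        (fun k _ => by simp [I.slot_pos k, I.slot_le k]) I.slot_strictMono.injective.injOn
      simpa using this
    omega
  have hv0 : 0 ≤ I.V (Z g₀) / ω := by positivity
  have h1 := I.orderProb_sample_value hω hZ hsmall
  have h2 := I.half_le_orderProb_bestValue (half_pos I.B_pos).le hsmall hv0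
  have h3 := le_orderProb_and
    (fun σ => 47 / 100 * I.V (Z g₀) ≤ I.V (Z g₀ ∩ I.sampleSet σ))
    (fun σ => I.bestValue (I.B / 2) (I.sampleSet σ) ≤
      I.bestValue (I.B / 2) (I.sampleSet σ)ᶜ + I.V (Z g₀) / ω)
  refine (le_trans (by linarith) h3).trans (orderProb_mono fun σ hσ => ?_)
  have h7 := V_le_seven_mul_propShare (g := g σ) hω hsmall hσ.1
  change _ ≤ 7 * I.V (Z₁' (g σ) σ) at h7
  refine ⟨h7, secondHalfRatio_mul_le (g σ) hT hδ hsmall (by linarith) ?_ hσ.2⟩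
  rw [div_mul_eq_mul_div]
  gcongr
  linarith

end Auction

theorem mainTheorem5 :
    ∃ p : ℝ, 0 < p ∧ ∃ (ω₀ : ℝ) (r : ℝ → ℝ → ℝ),
      (∀ δ : ℝ, 8 < δ → ∃ κ : ℝ, 0 < κ ∧ ∀ᶠ ω in atTop, κ ≤ r ω δ) ∧
      Tendsto (fun q : ℝ × ℝ => r q.1 q.2) (atTop ×ˢ 𝓝 12) (𝓝 (1 / 12)) ∧
      (∀ ω δ : ℝ, ω₀ ≤ ω → 1 < δ →
        ∀ (n : ℕ) (I : Auction n) (ε : ℝ) (g₀ : I.ArgmaxRule)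
          (g : Equiv.Perm (Fin n) → I.ArgmaxRule),
          0 < ε → (∀ i, I.V {i} ≤ I.V (Auction.Z g₀) / ω) →
          p ≤ orderProb fun σ =>
            I.V (Auction.Z g₀) ≤ 8 * I.V (Auction.Z₁' (g σ) σ) ∧
            r ω δ * I.V (Auction.Z₁' (g σ) σ) ≤ I.V (Auction.Z₂' (g σ) ε δ σ)) ∧
      (∀ᶠ q : ℝ × ℝ in atTop ×ˢ 𝓝 12,
        ∀ (n : ℕ) (I : Auction n) (ε : ℝ) (g₀ : I.ArgmaxRule)
          (g : Equiv.Perm (Fin n) → I.ArgmaxRule),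
          0 < ε → (∀ i, I.V {i} ≤ I.V (Auction.Z g₀) / q.1) →
          p ≤ orderProb fun σ =>
            I.V (Auction.Z g₀) ≤ 96 * I.V (Auction.Z₂' (g σ) ε q.2 σ)) := by
  refine ⟨1 / 4, by norm_num, 10000, Auction.secondHalfRatio, fun δ hδ =>
    ⟨1 / (2 * δ), by positivity, Auction.secondHalfRatio_eventually_ge hδ⟩,
    Auction.tendsto_secondHalfRatio, fun ω δ hω hδ n I ε g₀ g _ hsmall => ?_, ?_⟩
  · refine (I.quarter_le_orderProb_omz ε hω hδ g₀ g hsmall).trans (orderProb_mono fun σ hσ => ?_)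
    exact ⟨by linarith [hσ.1, I.nonneg (Auction.Z₁' (g σ) σ)], hσ.2⟩
  -- The slack between `7` and `8` lets a ratio slightly below the limit `1/12` suffice: `V(Z) ≤ 7
  -- V(Z₁')` needs only ratio `7/96` to give the factor `96`.
  · have hratio := Auction.tendsto_secondHalfRatio.eventually_const_lt
      (show (7 / 96 : ℝ) < 1 / 12 by norm_num)
    filter_upwards [hratio, tendsto_fst.eventually (eventually_ge_atTop (10000 : ℝ)),
      tendsto_snd.eventually (lt_mem_nhds (show (1 : ℝ) < 12 by norm_num))]
      with q hq hω hδ n I ε g₀ g _ hsmall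
    refine (I.quarter_le_orderProb_omz ε hω hδ g₀ g hsmall).trans (orderProb_mono fun σ hσ => ?_)
    have := mul_le_mul_of_nonneg_right hq.le (I.nonneg (Auction.Z₁' (g σ) σ))
    linarith [hσ.1, hσ.2]
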